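/- For a partition $\lambda=(\lambda_1\ge\lambda_2\ge\cdots\ge\lambda_m)$ into positive parts, write $\lambda\in\mathsf{Diff_2}$ if $\lambda_i-\lambda_{i+1}\ge 2$ for all $1\le i<m$. For $\lambda\in\mathsf{Diff_2}$ with $m$ parts, let $col(\lambda)$ be the partition whose parts are the column lengths of the Ferrers diagram with row lengths $(\lambda_1-(2m-1),\lambda_2-(2m-3),\dots,\lambda_m-1)$. Theorem. Let $M+1\ge 2$ be an integer congruent to $1$ or $4$ modulo $5$, let $N\ge 1$ and let $k\ge 0$. The number of partitions of $N$ into parts congruent to $1$ or $4$ modulo $5$ in which the part $M+1$ occurs exactly $k$ times is equal to the number of partitions $\lambda\in\mathsf{Diff_2}$ of $N$ such that one of the following holds: 1. $\lambda$ consists of exactly one part, of size $N=(M+1)k+i$ for some $0\le i\le M$; 2. $\lambda$ has between $2$ and $M$ parts, and $1$ occurs in $col(\lambda)$ at least $(M+1)k$ and at most $(M+1)k+M$ times; 3. $\lambda$ has at least $M+1$ parts, and $M+1$ occurs exactly $k$ times as a part of $col(\lambda)$. -/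

import Mathlib

/-- The parts of a partition, listed in weakly decreasing order `λ₁ ≥ λ₂ ≥ ⋯ ≥ λ_m`. -/
def partList {N : ℕ} (p : Nat.Partition N) : List ℕ :=
  p.parts.sort (· ≥ ·)

/-- `Diff₂`: the difference of any two consecutive parts is at least two. -/
def IsDiffTwo {N : ℕ} (p : Nat.Partition N) : Prop :=
  (partList p).IsChain (fun a b => b + 2 ≤ a)

/-- The column lengths of the Ferrers diagram with row lengths `rows`: for every `j` smaller than
the largest row length, the number of rows with more than `j` cells. -/
def columnLengths (rows : List ℕ) : Multiset ℕ :=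
  (Multiset.range (rows.foldr max 0)).map fun j => rows.countP (fun r => j < r)

/-- For `λ = (λ₁, …, λ_m)`, the sequence `(λ₁ - (2m-1), λ₂ - (2m-3), …, λ_m - 1)`.
In position `i` (counted from `0`) the number `2(m-i)-1` is subtracted. For a partition in `Diff₂`
this number is at most the part there, so that no subtraction truncates. -/
def reducedRows {N : ℕ} (p : Nat.Partition N) : List ℕ :=
  (partList p).mapIdx fun i a => a - (2 * ((partList p).length - i) - 1)

/-- `col(λ)`: the partition (as the multiset of its parts) formed by the columns of
`(λ₁ - (2m-1), …, λ_m - 1)`. -/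
def col {N : ℕ} (p : Nat.Partition N) : Multiset ℕ :=
  columnLengths (reducedRows p)

/-! Both families carry a statistic with the same shift property: the objects of size `N` correspond
to the objects of size `N + (M + 1)` with positive statistic, and the correspondence raises the
statistic by one. Hence statistic `0` at size `N + (M + 1)` is counted by a difference of two
totals, and statistic `k + 1` there is counted by statistic `k` at size `N`. The whole distribution
is therefore determined by the totals (`card_stat_eq_of_card_eq`), and these agree by the first
Rogers–Ramanujan identity.

For parts congruent to 1 or 4 modulo 5, the statistic is the multiplicity of `M + 1` and the shift
inserts such a part. In `Diff₂`, a partition with more than `M` parts has its first `M + 1` parts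
raised by one, which adds a column of length `M + 1`; one with at most `M` parts has its largest
part raised by `M + 1`, and the empty partition becomes the single part `M + 1`. Conditions 1–3 say
that this statistic equals `k` (`shiftStat_eq_iff`).

Rogers–Ramanujan follows Schur. The generating function of `Diff₂` partitions with parts below `n`
obeys a two-step recurrence, solved by an alternating sum of Gaussian binomials. Multiplied by `(1 -
q) ⋯ (1 - qⁿ)`, that sum tends to a theta series, which the Jacobi triple product factors. Limits
are replaced by congruences modulo `q ^ K`. -/

open PowerSeries

/-! ### Gaussian binomial coefficients -/

/-- The Gaussian binomial coefficient `[n; k]` at `q`, with `k` any integer. -/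
def gaussBinom {R : Type*} [CommRing R] (q : R) : ℕ → ℤ → R
  | 0, k => if k = 0 then 1 else 0
  | n + 1, k => gaussBinom q n (k - 1) + q ^ k.toNat * gaussBinom q n k

/-- The finite product `(1 - q) (1 - q²) ⋯ (1 - qⁿ)`. -/
def qFactorial {R : Type*} [CommRing R] (q : R) (n : ℕ) : R :=
  ∏ i ∈ Finset.range n, (1 - q ^ (i + 1))

section Gauss
variable {R : Type*} [CommRing R] (q : R)

theorem gaussBinom_of_neg (n : ℕ) : ∀ {k : ℤ}, k < 0 → gaussBinom q n k = 0 := by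
  induction n with
  | zero => intro k hk; simp [gaussBinom, hk.ne]
  | succ n ih => intro k hk; rw [gaussBinom, ih hk, ih (by lia)]; simp

theorem gaussBinom_of_lt (n : ℕ) : ∀ {k : ℤ}, (n : ℤ) < k → gaussBinom q n k = 0 := by
  induction n with
  | zero => intro k hk; simp only [gaussBinom]; rw [if_neg (by lia)]
  | succ n ih => intro k hk; push_cast at hk; rw [gaussBinom, ih (by lia), ih (by lia)]; simp

theorem gaussBinom_zero_right (n : ℕ) : gaussBinom q n 0 = 1 := by
  induction n with
  | zero => simp [gaussBinom]
  | succ n ih => rw [gaussBinom, ih, gaussBinom_of_neg q n (by lia)]; simp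

theorem gaussBinom_succ (n : ℕ) (k : ℤ) :
    gaussBinom q (n + 1) k = gaussBinom q n (k - 1) + q ^ k.toNat * gaussBinom q n k := rfl

/-- Exponents written with `toNat` add up correctly only for `0 ≤ k ≤ n`; elsewhere the coefficient
vanishes. -/
theorem pow_mul_pow_mul_gaussBinom {n a b a' b' : ℕ} {k : ℤ}
    (h : 0 ≤ k → k ≤ n → a + b = a' + b') :
    q ^ a * (q ^ b * gaussBinom q n k) = q ^ a' * (q ^ b' * gaussBinom q n k) := by
  rcases lt_or_ge k 0 with h0 | h0
  · simp [gaussBinom_of_neg q n h0]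
  rcases lt_or_ge (n : ℤ) k with h1 | h1
  · simp [gaussBinom_of_lt q n h1]
  rw [← mul_assoc, ← mul_assoc, ← pow_add, ← pow_add, h h0 h1]

/-- The mirror image of the defining Pascal rule. In the induction both terms of that rule are
expanded by the hypothesis and regrouped. -/
theorem gaussBinom_succ' (n : ℕ) : ∀ k : ℤ,
    gaussBinom q (n + 1) k =
      gaussBinom q n k + q ^ ((n : ℤ) + 1 - k).toNat * gaussBinom q n (k - 1) := by
  induction n with
  | zero =>
    intro k
    simp only [gaussBinom]
    rcases eq_or_ne k 0 with rfl | h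
    · simp
    rcases eq_or_ne k 1 with rfl | h'
    · simp
    · rw [if_neg (by lia), if_neg h]; simp
  | succ n ih =>
    intro k
    have key := pow_mul_pow_mul_gaussBinom q (n := n) (k := k - 1) (a := k.toNat)
      (b := ((n : ℤ) + 1 - k).toNat) (a' := ((n : ℤ) + 1 + 1 - k).toNat) (b' := (k - 1).toNat)
      (by lia)
    have e1 := ih (k - 1)
    have e2 := ih k
    have e3 := gaussBinom_succ q n k
    have e4 := gaussBinom_succ q n (k - 1)
    have e0 := gaussBinom_succ q (n + 1) k
    rw [show (n : ℤ) + 1 - (k - 1) = (n : ℤ) + 1 + 1 - k by ring] at e1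
    push_cast
    linear_combination e0 + e1 + q ^ k.toNat * e2 - e3 -
      q ^ ((n : ℤ) + 1 + 1 - k).toNat * e4 + key

/-- The first Pascal rule minus `q ^ (k + 1)` times the second. -/
theorem one_sub_pow_mul_gaussBinom_succ (n : ℕ) (k : ℕ) :
    (1 - q ^ (k + 1)) * gaussBinom q (n + 1) (k + 1 : ℕ) =
      (1 - q ^ (n + 1)) * gaussBinom q n k := by
  have h1 := gaussBinom_succ q n (k + 1 : ℕ)
  have h2 := gaussBinom_succ' q n (k + 1 : ℕ)
  have key := pow_mul_pow_mul_gaussBinom q (n := n) (k := k) (a := k + 1)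
      (b := ((n : ℤ) + 1 - (k + 1 : ℕ)).toNat) (a' := n + 1) (b' := 0)
      (by push_cast; lia)
  simp only [Int.toNat_natCast] at h1
  rw [show ((k + 1 : ℕ) : ℤ) - 1 = k by push_cast; ring] at h1 h2
  simp only [pow_zero, one_mul] at key
  linear_combination h1 - q ^ (k + 1) * h2 - key

theorem qFactorial_succ (n : ℕ) : qFactorial q (n + 1) = qFactorial q n * (1 - q ^ (n + 1)) :=
  Finset.prod_range_succ _ _

theorem qFactorial_mul_gaussBinom (a b : ℕ) :
    qFactorial q b * gaussBinom q (a + b) b = ∏ i ∈ Finset.range b, (1 - q ^ (a + i + 1)) := by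
  induction b with
  | zero => simp [qFactorial, gaussBinom_zero_right]
  | succ b ih =>
    rw [Finset.prod_range_succ, ← ih, qFactorial_succ, mul_assoc, ← add_assoc,
      one_sub_pow_mul_gaussBinom_succ]
    ring

theorem dvd_prod_one_sub_pow_sub_one {ι : Type*} (s : Finset ι) (e : ι → ℕ) (m : ℕ)
    (h : ∀ i ∈ s, m ≤ e i) : q ^ m ∣ ∏ i ∈ s, (1 - q ^ e i) - 1 := by
  classical
  induction s using Finset.induction_on with
  | empty => simp
  | insert a s ha ih =>
    rw [Finset.prod_insert ha]
    have h1 := ih fun i hi => h i (Finset.mem_insert_of_mem hi)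
    have h2 := pow_dvd_pow q (h a (Finset.mem_insert_self _ _))
    have : (1 - q ^ e a) * ∏ i ∈ s, (1 - q ^ e i) - 1 =
      (∏ i ∈ s, (1 - q ^ e i) - 1) - q ^ e a * ∏ i ∈ s, (1 - q ^ e i) := by ring
    rw [this]
    exact dvd_sub h1 (h2.mul_right _)

/-- The product is one of factors `1 - q ^ e` with every `e` above `min k (n - k)`. The case `m = 0`
serves the `k` out of range. -/
theorem pow_dvd_qFactorial_mul_gaussBinom_sub_one (n : ℕ) (k : ℤ) (m : ℕ)
    (h : m = 0 ∨ ((m : ℤ) ≤ k + 1 ∧ (m : ℤ) ≤ n - k + 1)) :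
    q ^ m ∣ qFactorial q n * gaussBinom q n k - 1 := by
  rcases Nat.eq_zero_or_pos m with rfl | hm
  · simp
  obtain ⟨h1, h2⟩ := h.resolve_left hm.ne'
  lift k to ℕ using (by lia) with b
  obtain ⟨a, rfl⟩ := Nat.exists_eq_add_of_le' (show b ≤ n by lia)
  have hQ : qFactorial q (a + b) = qFactorial q b * ∏ i ∈ Finset.range a, (1 - q ^ (b + i + 1)) := by
    rw [add_comm a b, qFactorial, Finset.prod_range_add]; rfl
  have e : qFactorial q (a + b) * gaussBinom q (a + b) b =
      (∏ i ∈ Finset.range b, (1 - q ^ (a + i + 1))) *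
        ∏ i ∈ Finset.range a, (1 - q ^ (b + i + 1)) := by
    rw [hQ, ← qFactorial_mul_gaussBinom q a b]; ring
  have d1 := dvd_prod_one_sub_pow_sub_one q (Finset.range b) (fun i => a + i + 1) m
    (fun i _ => by lia)
  have d2 := dvd_prod_one_sub_pow_sub_one q (Finset.range a) (fun i => b + i + 1) m
    (fun i _ => by lia)
  rw [e]
  convert dvd_add (d1.mul_right (∏ i ∈ Finset.range a, (1 - q ^ (b + i + 1)))) d2 using 1
  ring

/-- The exponents `j (5 j + 1) / 2` of the theta series modulo five. -/
def thetaExp (j : ℤ) : ℕ := (j * (5 * j + 1) / 2).toNat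

theorem two_mul_thetaExp (j : ℤ) : 2 * (thetaExp j : ℤ) = j * (5 * j + 1) := by
  have h2 : (2 : ℤ) ∣ j * (5 * j + 1) := by
    rcases Int.even_or_odd' j with ⟨c, rfl | rfl⟩
    · exact ⟨c * (5 * (2 * c) + 1), by ring⟩
    · exact ⟨(2 * c + 1) * (5 * c + 3), by ring⟩
  have h0 : 0 ≤ j * (5 * j + 1) := by
    rcases lt_or_ge j 0 with h | h
    · exact mul_nonneg_of_nonpos_of_nonpos h.le (by lia)
    · positivity
  rw [thetaExp, Int.toNat_of_nonneg (Int.ediv_nonneg h0 (by norm_num))]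
  exact Int.mul_ediv_cancel' h2

theorem thetaExp_succ (j : ℤ) : (thetaExp (j + 1) : ℤ) = thetaExp j + 5 * j + 3 := by
  have h1 := two_mul_thetaExp j
  have h2 := two_mul_thetaExp (j + 1)
  have : (2 : ℤ) * thetaExp (j + 1) = 2 * (thetaExp j + 5 * j + 3) := by
    rw [h2]; linear_combination -h1
  lia

/-- The sign `(-1) ^ j`. -/
def altSign (R : Type*) [CommRing R] (j : ℤ) : R := ((Int.negOnePow j : ℤˣ) : ℤ)

theorem altSign_succ (j : ℤ) : altSign R (j + 1) = -altSign R j := by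
  simp [altSign, Int.negOnePow_succ]

theorem altSign_pred (j : ℤ) : altSign R (j - 1) = -altSign R j := by
  simp [altSign, Int.negOnePow_sub]

theorem finite_support_mul_gaussBinom (q : R) (n : ℕ) (c : ℤ → R) (f : ℤ → ℤ)
    (hf : ∀ m : ℤ, {j | f j = m}.Finite) :
    (Function.support fun j => c j * gaussBinom q n (f j)).Finite := by
  have : (⋃ m ∈ Finset.Icc (0 : ℤ) n, {j | f j = m}).Finite :=
    Set.Finite.biUnion (Finset.finite_toSet _) fun m _ => hf m
  refine this.subset fun j hj => ?_
  have hj' : gaussBinom q n (f j) ≠ 0 := right_ne_zero_of_mul hj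
  have h1 : 0 ≤ f j := not_lt.1 fun h => hj' (gaussBinom_of_neg q n h)
  have h2 : f j ≤ n := not_lt.1 fun h => hj' (gaussBinom_of_lt q n h)
  simp [h1, h2]

end Gauss

/-! ### Finite Jacobi triple product modulo five -/

section Theta
variable {R : Type*} [CommRing R] (q : R)

/-- The summands of the finite form of the Jacobi triple product modulo five. -/
def jacobiTerm (m n : ℕ) (j : ℤ) : R :=
  altSign R j * q ^ thetaExp j * gaussBinom (q ^ 5) (m + n) (n + j)

theorem finite_support_jacobiTerm (m n : ℕ) : (Function.support (jacobiTerm q m n)).Finite :=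
  finite_support_mul_gaussBinom (q ^ 5) (m + n) _ (fun j => n + j) fun k =>
    (Set.finite_singleton (k - n)).subset fun j (hj : (n : ℤ) + j = k) => by
      simp only [Set.mem_singleton_iff]; lia

/-- The increment `5 j - 2` of the theta exponent cancels the `j` in the Pascal power, leaving `5 m
+ 3`. Summed over `j`, the relation thus becomes multiplication by one factor. -/
theorem jacobiTerm_succ_left (m n : ℕ) (j : ℤ) :
    jacobiTerm q (m + 1) n j =
      jacobiTerm q m n j - q ^ (5 * m + 3) * jacobiTerm q m n (j - 1) := by
  have ht := thetaExp_succ (j - 1)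
  rw [sub_add_cancel] at ht
  have h1 := gaussBinom_succ' (q ^ 5) (m + n) (n + j)
  have key : q ^ thetaExp j * ((q ^ 5) ^ (((m + n : ℕ) : ℤ) + 1 - (n + j)).toNat *
        gaussBinom (q ^ 5) (m + n) (n + j - 1)) =
      q ^ (5 * m + 3) * (q ^ thetaExp (j - 1) * gaussBinom (q ^ 5) (m + n) (n + j - 1)) := by
    rcases lt_or_ge ((m + n : ℕ) : ℤ) (n + j - 1) with h | h
    · simp [gaussBinom_of_lt _ _ h]
    · rw [← mul_assoc, ← mul_assoc, ← pow_mul, ← pow_add, ← pow_add]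
      congr 2
      push_cast at h ⊢
      lia
  unfold jacobiTerm
  rw [altSign_pred, show m + 1 + n = m + n + 1 by ring, h1,
    show (n : ℤ) + (j - 1) = n + j - 1 by ring]
  linear_combination altSign R j * key

theorem jacobiTerm_succ_right (m n : ℕ) (j : ℤ) :
    jacobiTerm q m (n + 1) j =
      jacobiTerm q m n j - q ^ (5 * n + 2) * jacobiTerm q m n (j + 1) := by
  have ht := thetaExp_succ j
  have h1 := gaussBinom_succ (q ^ 5) (m + n) (n + 1 + j)
  have key : q ^ thetaExp j * ((q ^ 5) ^ ((n : ℤ) + 1 + j).toNat *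
        gaussBinom (q ^ 5) (m + n) (n + 1 + j)) =
      q ^ (5 * n + 2) * (q ^ thetaExp (j + 1) * gaussBinom (q ^ 5) (m + n) (n + 1 + j)) := by
    rcases lt_or_ge ((n : ℤ) + 1 + j) 0 with h | h
    · simp [gaussBinom_of_neg _ _ h]
    · rw [← mul_assoc, ← mul_assoc, ← pow_mul, ← pow_add, ← pow_add]
      congr 2
      lia
  unfold jacobiTerm
  rw [altSign_succ, ← add_assoc m n 1, show (((n + 1 : ℕ) : ℤ) + j) = n + 1 + j by push_cast; ring,
    h1, show (n : ℤ) + (j + 1) = n + 1 + j by ring, show (n : ℤ) + 1 + j - 1 = n + j by ring]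
  linear_combination altSign R j * key

theorem finsum_jacobiTerm_succ_left (m n : ℕ) :
    ∑ᶠ j, jacobiTerm q (m + 1) n j = (1 - q ^ (5 * m + 3)) * ∑ᶠ j, jacobiTerm q m n j := by
  have hf := finite_support_jacobiTerm q m n
  have hf' : (Function.support fun j => jacobiTerm q m n (j - 1)).Finite :=
    hf.preimage ((Equiv.subRight (1 : ℤ)).injective.injOn)
  have hs : ∑ᶠ j, jacobiTerm q m n (j - 1) = ∑ᶠ j, jacobiTerm q m n j :=
    finsum_comp_equiv (Equiv.subRight (1 : ℤ))
  simp_rw [jacobiTerm_succ_left q m n]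
  rw [finsum_sub_distrib hf (hf'.subset (Function.support_mul_subset_right _ _)),
    ← mul_finsum' _ _ hf', hs]
  ring

theorem finsum_jacobiTerm_succ_right (m n : ℕ) :
    ∑ᶠ j, jacobiTerm q m (n + 1) j = (1 - q ^ (5 * n + 2)) * ∑ᶠ j, jacobiTerm q m n j := by
  have hf := finite_support_jacobiTerm q m n
  have hf' : (Function.support fun j => jacobiTerm q m n (j + 1)).Finite :=
    hf.preimage ((Equiv.addRight (1 : ℤ)).injective.injOn)
  have hs : ∑ᶠ j, jacobiTerm q m n (j + 1) = ∑ᶠ j, jacobiTerm q m n j :=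
    finsum_comp_equiv (Equiv.addRight (1 : ℤ))
  simp_rw [jacobiTerm_succ_right q m n]
  rw [finsum_sub_distrib hf (hf'.subset (Function.support_mul_subset_right _ _)),
    ← mul_finsum' _ _ hf', hs]
  ring

/-- A finite form of the Jacobi triple product identity. -/
theorem finsum_jacobiTerm (n : ℕ) :
    ∑ᶠ j, jacobiTerm q n n j =
      ∏ i ∈ Finset.range n, ((1 - q ^ (5 * i + 2)) * (1 - q ^ (5 * i + 3))) := by
  induction n with
  | zero =>
    rw [finsum_eq_single _ 0]
    · simp [jacobiTerm, gaussBinom, altSign, thetaExp]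
    · intro j hj; simp [jacobiTerm, gaussBinom, hj]
  | succ n ih =>
    rw [Finset.prod_range_succ, ← ih, finsum_jacobiTerm_succ_right, finsum_jacobiTerm_succ_left]
    ring

/-! ### Schur's polynomials and their recurrence -/

/-- The summands of Schur's polynomials. -/
def schurTerm (n : ℕ) (j : ℤ) : R :=
  altSign R j * q ^ thetaExp j * gaussBinom q n ((n - 5 * j) / 2)

theorem finite_support_schurTerm (n : ℕ) : (Function.support (schurTerm q n)).Finite :=
  finite_support_mul_gaussBinom q n _ (fun j => (n - 5 * j) / 2) fun k =>
    (Finset.finite_toSet (Finset.Icc (-(n + 2 * |k| + 2)) (n + 2 * |k| + 2))).subset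
      fun j (hj : ((n : ℤ) - 5 * j) / 2 = k) => by
        simp only [Finset.coe_Icc, Set.mem_Icc]
        have := le_abs_self k
        have := neg_abs_le k
        lia

/-- Terms whose differences measure how far Schur's summands are from satisfying the recurrence. -/
def schurDefect (n : ℕ) (j : ℤ) : R :=
  if Even (n - 5 * j) then
    altSign R j * q ^ thetaExp j *
      (q ^ ((n + 2 - 5 * j) / 2).toNat * gaussBinom q n ((n + 2 - 5 * j) / 2))
  else 0

/-- The two Pascal rules are applied in an order dictated by the parity of `n - 5 j`. One term is
left over each time; as parity alternates with `j`, the leftovers are the defect at `j` or at `j +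
1`, and they telescope in the sum. -/
theorem schurTerm_add_two (n : ℕ) (j : ℤ) :
    schurTerm q (n + 2) j =
      schurTerm q (n + 1) j + q ^ (n + 1) * schurTerm q n j +
        (schurDefect q n j - schurDefect q n (j + 1)) := by
  rcases Int.even_or_odd' ((n : ℤ) - 5 * j) with ⟨c, hc | hc⟩
  · have e1 : (((n + 2 : ℕ) : ℤ) - 5 * j) / 2 = c + 1 := by push_cast; lia
    have e2 : (((n + 1 : ℕ) : ℤ) - 5 * j) / 2 = c := by push_cast; lia
    have e3 : ((n : ℤ) - 5 * j) / 2 = c := by lia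
    have e4 : ((n : ℤ) + 2 - 5 * j) / 2 = c + 1 := by lia
    have p1 : Even ((n : ℤ) - 5 * j) := ⟨c, by lia⟩
    have p2 : ¬ Even ((n : ℤ) - 5 * (j + 1)) := by
      rw [Int.not_even_iff_odd]; exact ⟨c - 3, by lia⟩
    have h1 := gaussBinom_succ q (n + 1) (c + 1)
    have h2 := gaussBinom_succ' q n (c + 1)
    rw [add_sub_cancel_right] at h1 h2
    have key := pow_mul_pow_mul_gaussBinom q (n := n) (k := c) (a := (c + 1).toNat)
      (b := ((n : ℤ) + 1 - (c + 1)).toNat) (a' := n + 1) (b' := 0) (by lia)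
    rw [pow_zero, one_mul] at key
    unfold schurDefect schurTerm
    rw [if_pos p1, if_neg p2, e1, e2, e3, e4]
    linear_combination altSign R j * q ^ thetaExp j * (h1 + q ^ (c + 1).toNat * h2 + key)
  · have e1 : (((n + 2 : ℕ) : ℤ) - 5 * j) / 2 = c + 1 := by push_cast; lia
    have e2 : (((n + 1 : ℕ) : ℤ) - 5 * j) / 2 = c + 1 := by push_cast; lia
    have e3 : ((n : ℤ) - 5 * j) / 2 = c := by lia
    have e4 : ((n : ℤ) + 2 - 5 * (j + 1)) / 2 = c - 1 := by lia
    have p1 : ¬ Even ((n : ℤ) - 5 * j) := by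
      rw [Int.not_even_iff_odd]; exact ⟨c, by lia⟩
    have p2 : Even ((n : ℤ) - 5 * (j + 1)) := ⟨c - 2, by lia⟩
    have h1 := gaussBinom_succ' q (n + 1) (c + 1)
    have h2 := gaussBinom_succ q n c
    rw [add_sub_cancel_right] at h1
    have key := pow_mul_pow_mul_gaussBinom q (n := n) (k := c)
      (a := (((n + 1 : ℕ) : ℤ) + 1 - (c + 1)).toNat)
      (b := c.toNat) (a' := n + 1) (b' := 0) (by push_cast; lia)
    rw [pow_zero, one_mul] at key
    have ht := thetaExp_succ j
    have key2 : q ^ thetaExp j * (q ^ (((n + 1 : ℕ) : ℤ) + 1 - (c + 1)).toNat *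
          gaussBinom q n (c - 1)) =
        q ^ thetaExp (j + 1) * (q ^ (c - 1).toNat * gaussBinom q n (c - 1)) := by
      apply pow_mul_pow_mul_gaussBinom
      push_cast
      lia
    unfold schurDefect schurTerm
    rw [if_neg p1, if_pos p2, e1, e2, e3, e4, altSign_succ]
    linear_combination altSign R j * q ^ thetaExp j *
      (h1 + q ^ (((n + 1 : ℕ) : ℤ) + 1 - (c + 1)).toNat * h2 + key) + altSign R j * key2

theorem finite_support_schurDefect (n : ℕ) : (Function.support (schurDefect q n)).Finite := by
  have h := finite_support_mul_gaussBinom q n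
    (fun j => altSign R j * q ^ thetaExp j * q ^ (((n : ℤ) + 2 - 5 * j) / 2).toNat)
    (fun j => (n + 2 - 5 * j) / 2) fun k =>
    (Finset.finite_toSet (Finset.Icc (-(n + 2 * |k| + 4)) (n + 2 * |k| + 4))).subset
      fun j (hj : ((n : ℤ) + 2 - 5 * j) / 2 = k) => by
        simp only [Finset.coe_Icc, Set.mem_Icc]
        have := le_abs_self k
        have := neg_abs_le k
        lia
  refine h.subset fun j hj hj' => hj ?_
  rw [schurDefect]
  split_ifs
  · rw [← mul_assoc]; exact hj'
  · rfl

theorem finsum_schurTerm_add_two (n : ℕ) :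
    ∑ᶠ j, schurTerm q (n + 2) j =
      ∑ᶠ j, schurTerm q (n + 1) j + q ^ (n + 1) * ∑ᶠ j, schurTerm q n j := by
  have hf := finite_support_schurTerm q n
  have hf' := finite_support_schurTerm q (n + 1)
  have hd := finite_support_schurDefect q n
  have hd' : (Function.support fun j => schurDefect q n (j + 1)).Finite :=
    hd.preimage ((Equiv.addRight (1 : ℤ)).injective.injOn)
  have hs : ∑ᶠ j, schurDefect q n (j + 1) = ∑ᶠ j, schurDefect q n j :=
    finsum_comp_equiv (Equiv.addRight (1 : ℤ))
  have hm : (Function.support fun j => q ^ (n + 1) * schurTerm q n j).Finite :=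
    hf.subset (Function.support_mul_subset_right _ _)
  simp_rw [schurTerm_add_two q n]
  rw [finsum_add_distrib ((hf'.union hm).subset (Function.support_add _ _))
      ((hd.union hd').subset (Function.support_sub _ _)),
    finsum_add_distrib hf' hm, finsum_sub_distrib hd hd', hs, ← mul_finsum' _ _ hf]
  ring

theorem finsum_schurTerm_zero : ∑ᶠ j, schurTerm q 0 j = 1 := by
  rw [finsum_eq_single _ 0]
  · simp [schurTerm, gaussBinom, altSign, thetaExp]
  · intro j hj
    rw [schurTerm, gaussBinom, if_neg (by push_cast; lia), mul_zero]

theorem finsum_schurTerm_one : ∑ᶠ j, schurTerm q 1 j = 1 := by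
  rw [finsum_eq_single _ 0]
  · simp [schurTerm, gaussBinom, altSign, thetaExp]
  · intro j hj
    rw [schurTerm]
    rcases lt_or_gt_of_ne hj with h | h
    · rw [gaussBinom_of_lt _ _ (by push_cast; lia), mul_zero]
    · rw [gaussBinom_of_neg _ _ (by push_cast; lia), mul_zero]

/-! ### Convergence to the theta series -/

theorem abs_le_thetaExp (j : ℤ) : |j| ≤ thetaExp j := by
  have := two_mul_thetaExp j
  rcases le_or_gt 0 j with h | h
  · rw [abs_of_nonneg h]; nlinarith
  · rw [abs_of_neg h]; nlinarith

theorem dvd_finsum {ι : Type*} {d : R} {f : ι → R} (h : ∀ i, d ∣ f i) : d ∣ ∑ᶠ i, f i :=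
  finsum_induction (d ∣ ·) (dvd_zero d) (fun _ _ => dvd_add) h

theorem pow_dvd_qFactorial_mul_schurTerm_sub (K : ℕ) (j : ℤ) :
    q ^ K ∣ qFactorial q (2 * K) * schurTerm q (2 * K) j - altSign R j * q ^ thetaExp j := by
  have ht := two_mul_thetaExp j
  -- These are `2 θ(j) - 5 j` and `2 θ(j) + 5 j` for `θ = thetaExp`; the bounds keep the index `⌊(2K
  -- - 5j)/2⌋` far enough from `0` and from `2K`.
  have h0 : -1 ≤ j * (5 * j - 4) := by
    rcases le_or_gt j 0 with h | h <;> nlinarith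
  have h1 : -1 ≤ j * (5 * j + 6) := by
    rcases le_or_gt 0 j with h | h
    · nlinarith
    · rcases eq_or_ne j (-1) with rfl | h'
      · norm_num
      · have : j ≤ -2 := by lia
        nlinarith
  have key := pow_dvd_qFactorial_mul_gaussBinom_sub_one q (2 * K)
    ((((2 * K : ℕ) : ℤ) - 5 * j) / 2) (K - thetaExp j) (by
      rw [or_iff_not_imp_left]
      intro hne
      rw [Nat.cast_sub (by lia)]
      push_cast
      ring_nf at ht h0 h1 ⊢
      constructor <;> lia)
  have h2 : q ^ K ∣ q ^ thetaExp j * q ^ (K - thetaExp j) := by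
    rw [← pow_add]; exact pow_dvd_pow q (by lia)
  convert (h2.trans (mul_dvd_mul_left _ key)).mul_left (altSign R j) using 1
  rw [schurTerm]
  ring

theorem pow_dvd_qFactorial_mul_jacobiTerm_sub (K : ℕ) (j : ℤ) :
    q ^ K ∣ qFactorial (q ^ 5) (2 * K) * jacobiTerm q K K j - altSign R j * q ^ thetaExp j := by
  have ht := abs_le_thetaExp j
  have h3 := le_abs_self j
  have h4 := neg_abs_le j
  have key := pow_dvd_qFactorial_mul_gaussBinom_sub_one (q ^ 5) (K + K)
    (K + j) (K - thetaExp j) (by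
      rw [or_iff_not_imp_left]
      intro hne
      rw [Nat.cast_sub (by lia)]
      push_cast
      lia)
  rw [← pow_mul] at key
  have h2 : q ^ K ∣ q ^ thetaExp j * q ^ (5 * (K - thetaExp j)) := by
    rw [← pow_add]; exact pow_dvd_pow q (by lia)
  convert (h2.trans (mul_dvd_mul_left _ key)).mul_left (altSign R j) using 1
  rw [jacobiTerm, two_mul]
  ring

/-- Schur's polynomials converge to the product side of the first Rogers–Ramanujan identity. -/
theorem pow_dvd_qFactorial_mul_finsum_schurTerm_sub (K : ℕ) :
    q ^ K ∣ qFactorial q (2 * K) * ∑ᶠ j, schurTerm q (2 * K) j - qFactorial (q ^ 5) (2 * K) *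
      ∏ i ∈ Finset.range K, ((1 - q ^ (5 * i + 2)) * (1 - q ^ (5 * i + 3))) := by
  have h1 := finite_support_schurTerm q (2 * K)
  have h2 := finite_support_jacobiTerm q K K
  rw [← finsum_jacobiTerm, mul_finsum' _ _ h1, mul_finsum' _ _ h2,
    ← finsum_sub_distrib (h1.subset (Function.support_mul_subset_right _ _))
      (h2.subset (Function.support_mul_subset_right _ _))]
  refine dvd_finsum fun j => ?_
  convert dvd_sub (pow_dvd_qFactorial_mul_schurTerm_sub q K j)
    (pow_dvd_qFactorial_mul_jacobiTerm_sub q K j) using 1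
  ring

end Theta

/-! ### Statistics raised by a shift of the size -/

section Shift

/-- If `σ` identifies the elements of size `N` with the elements of size `N + a` on which the
statistic `s` is positive, then removing those with `s = 0` is a subtraction. -/
theorem card_add_eq_card_stat_zero_add {F : ℕ → Type*} [∀ N, Finite (F N)] (s : ∀ N, F N → ℕ)
    {a : ℕ} (σ : ∀ N, F N ≃ {x : F (N + a) // 1 ≤ s (N + a) x}) (N : ℕ) :
    Nat.card (F (N + a)) = Nat.card {x : F (N + a) // s (N + a) x = 0} + Nat.card (F N) := by
  classical
  rw [Nat.card_congr (σ N), ← Nat.card_sum]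
  refine Nat.card_congr ((Equiv.sumCompl fun x => s (N + a) x = 0).symm.trans
    (Equiv.sumCongr (Equiv.refl _) (Equiv.subtypeEquivRight fun x => ?_)))
  rw [Nat.one_le_iff_ne_zero]

theorem card_stat_add_one {F : ℕ → Type*} (s : ∀ N, F N → ℕ) {a : ℕ}
    (σ : ∀ N, F N ≃ {x : F (N + a) // 1 ≤ s (N + a) x})
    (hσ : ∀ N x, s (N + a) (σ N x).1 = s N x + 1) (N k : ℕ) :
    Nat.card {x : F (N + a) // s (N + a) x = k + 1} = Nat.card {x : F N // s N x = k} := by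
  refine Nat.card_congr ?_
  refine Equiv.trans ?_ ((σ N).subtypeEquiv (p := fun x => s N x = k)
    (q := fun y => s (N + a) y.1 = k + 1) fun x => by rw [hσ]; lia).symm
  exact (Equiv.subtypeSubtypeEquivSubtype fun {x} (hx : s (N + a) x = k + 1) => by lia).symm

/-- A statistic that is raised by one by a shift of the size is equidistributed over any two
families with the same cardinalities. -/
theorem card_stat_eq_of_card_eq {F G : ℕ → Type*} [∀ N, Finite (F N)] [∀ N, Finite (G N)]
    (s : ∀ N, F N → ℕ) (t : ∀ N, G N → ℕ) {a : ℕ}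
    (σ : ∀ N, F N ≃ {x : F (N + a) // 1 ≤ s (N + a) x})
    (hσ : ∀ N x, s (N + a) (σ N x).1 = s N x + 1) (hs : ∀ N < a, ∀ x, s N x = 0)
    (τ : ∀ N, G N ≃ {x : G (N + a) // 1 ≤ t (N + a) x})
    (hτ : ∀ N x, t (N + a) (τ N x).1 = t N x + 1) (ht : ∀ N < a, ∀ x, t N x = 0)
    (h : ∀ N, Nat.card (F N) = Nat.card (G N)) (k : ℕ) :
    ∀ N, Nat.card {x : F N // s N x = k} = Nat.card {x : G N // t N x = k} := by
  induction k with
  | zero =>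
    intro N
    rcases lt_or_ge N a with hN | hN
    · rw [Nat.card_congr (Equiv.subtypeUnivEquiv (hs N hN)),
        Nat.card_congr (Equiv.subtypeUnivEquiv (ht N hN)), h]
    · obtain ⟨N, rfl⟩ := Nat.exists_eq_add_of_le' hN
      have h1 := card_add_eq_card_stat_zero_add s σ N
      have h2 := card_add_eq_card_stat_zero_add t τ N
      have h3 := h N
      have h4 := h (N + a)
      lia
  | succ k ih =>
    intro N
    rcases lt_or_ge N a with hN | hN
    · have e1 : IsEmpty {x : F N // s N x = k + 1} := ⟨fun x => by
        have := hs N hN x.1; have := x.2; lia⟩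
      have e2 : IsEmpty {x : G N // t N x = k + 1} := ⟨fun x => by
        have := ht N hN x.1; have := x.2; lia⟩
      simp
    · obtain ⟨N, rfl⟩ := Nat.exists_eq_add_of_le' hN
      rw [card_stat_add_one s σ hσ, card_stat_add_one t τ hτ, ih]

end Shift

/-! ### Partitions with restricted parts -/

section Restricted

/-- The partitions of `N` all of whose parts satisfy `P`. -/
abbrev RestrictedPartition (P : ℕ → Prop) (N : ℕ) : Type :=
  {μ : Nat.Partition N // ∀ x ∈ μ.parts, P x}

/-- Insertion of a part `a`. -/
def RestrictedPartition.insertPart {P : ℕ → Prop} {a : ℕ} (ha : 0 < a) (hP : P a) (N : ℕ) :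
    RestrictedPartition P N ≃
      {μ : RestrictedPartition P (N + a) // 1 ≤ μ.1.parts.count a} where
  toFun μ := ⟨⟨⟨a ::ₘ μ.1.parts, fun {i} hi => by
      rcases Multiset.mem_cons.1 hi with rfl | hi
      · exact ha
      · exact μ.1.parts_pos hi,
      by rw [Multiset.sum_cons, μ.1.parts_sum, add_comm]⟩,
      fun x hx => by
        rcases Multiset.mem_cons.1 hx with rfl | hx
        · exact hP
        · exact μ.2 x hx⟩,
      by simp⟩
  invFun μ := ⟨⟨μ.1.1.parts.erase a, fun {i} hi => μ.1.1.parts_pos (Multiset.mem_of_mem_erase hi),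
      by
        have h1 := Multiset.sum_erase (Multiset.one_le_count_iff_mem.1 μ.2)
        have h2 := μ.1.1.parts_sum
        lia⟩,
      fun x hx => μ.1.2 x (Multiset.mem_of_mem_erase hx)⟩
  left_inv μ := by
    apply Subtype.ext
    apply Nat.Partition.ext
    simp
  right_inv μ := by
    apply Subtype.ext
    apply Subtype.ext
    apply Nat.Partition.ext
    exact Multiset.cons_erase (Multiset.one_le_count_iff_mem.1 μ.2)

theorem RestrictedPartition.count_insertPart {P : ℕ → Prop} {a : ℕ} (ha : 0 < a) (hP : P a) (N : ℕ)
    (μ : RestrictedPartition P N) :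
    (insertPart ha hP N μ).1.1.parts.count a = μ.1.parts.count a + 1 :=
  Multiset.count_cons_self _ _

theorem Nat.Partition.count_eq_zero_of_lt {N a : ℕ} (h : N < a) (μ : Nat.Partition N) :
    μ.parts.count a = 0 := by
  rw [Multiset.count_eq_zero]
  intro ha
  have := Multiset.le_sum_of_mem ha
  rw [μ.parts_sum] at this
  lia

/-- The generating function of the partitions all of whose parts satisfy `P`. -/
noncomputable def restrictedSeries (P : ℕ → Prop) : ℤ⟦X⟧ :=
  PowerSeries.mk fun N => (Nat.card (RestrictedPartition P N) : ℤ)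

/-- Inserting `a` shows that `X ^ a` times the series counts the partitions containing `a`. -/
theorem restrictedSeries_mul_one_sub {P Q : ℕ → Prop} {a : ℕ} (ha : 0 < a) (hP : P a)
    (hQ : ∀ x, Q x ↔ P x ∧ x ≠ a) :
    restrictedSeries P * (1 - X ^ a) = restrictedSeries Q := by
  have card_zero (N : ℕ) : Nat.card {μ : RestrictedPartition P N // μ.1.parts.count a = 0} =
      Nat.card (RestrictedPartition Q N) := by
    refine Nat.card_congr ((Equiv.subtypeSubtypeEquivSubtypeInter _
      (fun μ : Nat.Partition N => μ.parts.count a = 0)).trans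
      (Equiv.subtypeEquivRight fun μ => ?_))
    simp only [Multiset.count_eq_zero, hQ]
    exact ⟨fun h x hx => ⟨h.1 x hx, fun e => h.2 (e ▸ hx)⟩,
      fun h => ⟨fun x hx => (h x hx).1, fun hx => (h a hx).2 rfl⟩⟩
  ext N
  rw [mul_sub, mul_one, map_sub, PowerSeries.coeff_mul_X_pow']
  simp only [restrictedSeries, PowerSeries.coeff_mk]
  split_ifs with h
  · obtain ⟨N, rfl⟩ := Nat.exists_eq_add_of_le' h
    rw [card_add_eq_card_stat_zero_add (fun N (μ : RestrictedPartition P N) => μ.1.parts.count a)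
      (RestrictedPartition.insertPart ha hP) N, card_zero]
    simp
  · rw [← card_zero, sub_zero, Nat.card_congr (Equiv.subtypeUnivEquiv
      fun μ : RestrictedPartition P N =>
        Nat.Partition.count_eq_zero_of_lt (lt_of_not_ge h) μ.1)]

/-- Congruence to `1` or `4` modulo `5`. -/
def IsOneOrFourModFive (x : ℕ) : Prop := x ≡ 1 [MOD 5] ∨ x ≡ 4 [MOD 5]

theorem restrictedSeries_mul_prod (n : ℕ) :
    restrictedSeries IsOneOrFourModFive *
        ∏ i ∈ Finset.range n, ((1 - X ^ (5 * i + 1)) * (1 - X ^ (5 * i + 4))) =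
      restrictedSeries fun x => IsOneOrFourModFive x ∧ 5 * n < x := by
  induction n with
  | zero =>
    rw [Finset.prod_range_zero, mul_one]
    congr 1
    ext x
    simp only [IsOneOrFourModFive, Nat.ModEq]
    lia
  | succ n ih =>
    rw [Finset.prod_range_succ, ← mul_assoc, ih, ← mul_assoc,
      restrictedSeries_mul_one_sub
        (Q := fun x => (IsOneOrFourModFive x ∧ 5 * n < x) ∧ x ≠ 5 * n + 1) (by lia) ?_
        fun x => Iff.rfl,
      restrictedSeries_mul_one_sub (by lia) ?_ fun x => ?_]
    all_goals simp only [IsOneOrFourModFive, Nat.ModEq]; lia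

theorem X_pow_dvd_restrictedSeries_sub_one {P : ℕ → Prop} {n : ℕ} (h : ∀ x, P x → n < x) :
    X ^ n ∣ restrictedSeries P - 1 := by
  rw [PowerSeries.X_pow_dvd_iff]
  intro N hN
  rw [map_sub, restrictedSeries, PowerSeries.coeff_mk, PowerSeries.coeff_one]
  split_ifs with h0
  · subst h0
    have : ∀ μ : Nat.Partition 0, ∀ x ∈ μ.parts, P x := fun μ x hx => by
      rw [Subsingleton.elim μ default] at hx
      simp at hx
    rw [Nat.card_congr (Equiv.subtypeUnivEquiv this)]
    simp
  · have : IsEmpty (RestrictedPartition P N) := ⟨fun μ => by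
      have hne : μ.1.parts ≠ 0 := fun e => h0 (by rw [← μ.1.parts_sum, e, Multiset.sum_zero])
      obtain ⟨x, hx⟩ := Multiset.exists_mem_of_ne_zero hne
      have h1 := h x (μ.2 x hx)
      have h2 := Multiset.le_sum_of_mem hx
      rw [μ.1.parts_sum] at h2
      lia⟩
    simp

end Restricted

/-! ### Generating functions for parts differing by at least two -/

section DiffTwo

/-- The lists of positive integers with sum `N` whose entries decrease by at least two. -/
def IsDiffTwoList (N : ℕ) (l : List ℕ) : Prop :=
  l.Pairwise (fun a b => b + 2 ≤ a) ∧ (∀ x ∈ l, 0 < x) ∧ l.sum = N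

theorem isChain_iff_pairwise_add_two_le (l : List ℕ) :
    l.IsChain (fun a b => b + 2 ≤ a) ↔ l.Pairwise (fun a b => b + 2 ≤ a) :=
  haveI : IsTrans ℕ (fun a b => b + 2 ≤ a) := ⟨fun _ _ _ _ _ => by lia⟩
  List.isChain_iff_pairwise

theorem coe_partList {N : ℕ} (p : Nat.Partition N) : (partList p : Multiset ℕ) = p.parts :=
  Multiset.sort_eq _ _

theorem sort_coe_of_pairwise {l : List ℕ} (h : l.Pairwise (fun a b => b + 2 ≤ a)) :
    (l : Multiset ℕ).sort (· ≥ ·) = l := by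
  refine List.Perm.eq_of_pairwise' (r := (· ≥ ·)) (Multiset.pairwise_sort _ _)
    (h.imp fun {a b} h => by lia) ?_
  exact Multiset.coe_eq_coe.1 (Multiset.sort_eq _ _)

/-- A partition into parts differing by at least two is the list of its parts. -/
def diffTwoEquiv (N : ℕ) : {p : Nat.Partition N // IsDiffTwo p} ≃ {l // IsDiffTwoList N l} where
  toFun p := ⟨partList p.1, (isChain_iff_pairwise_add_two_le _).1 p.2,
    fun x hx => p.1.parts_pos (by rw [← coe_partList]; exact hx),
    by simpa only [← coe_partList, Multiset.sum_coe] using p.1.parts_sum⟩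
  invFun l := ⟨⟨l.1, fun {i} hi => l.2.2.1 i hi, by rw [Multiset.sum_coe, l.2.2.2]⟩, by
    rw [IsDiffTwo, partList, sort_coe_of_pairwise l.2.1, isChain_iff_pairwise_add_two_le]
    exact l.2.1⟩
  left_inv p := Subtype.ext (Nat.Partition.ext (coe_partList p.1))
  right_inv l := Subtype.ext (sort_coe_of_pairwise l.2.1)

instance (N : ℕ) : Finite {l // IsDiffTwoList N l} := Finite.of_equiv _ (diffTwoEquiv N)

/-- The lists of `IsDiffTwoList` with all entries smaller than `n`. -/
abbrev DiffTwoListLT (n N : ℕ) : Type :=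
  {l : {l // IsDiffTwoList N l} // ∀ x ∈ l.1, x < n}

/-- Removal of the largest possible entry. -/
def DiffTwoListLT.tailEquiv (n N : ℕ) :
    {l : DiffTwoListLT (n + 2) (N + (n + 1)) // n + 1 ∈ l.1.1} ≃ DiffTwoListLT n N where
  toFun l := ⟨⟨l.1.1.1.tail, by
      obtain ⟨⟨⟨l, hl⟩, hlt⟩, hm⟩ := l
      match l with
      | [] => simp at hm
      | a :: t =>
        obtain ⟨h1, h2, h3⟩ := hl
        rw [List.pairwise_cons] at h1
        have ha : a = n + 1 := by
          rcases List.mem_cons.1 hm with h | h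
          · exact h.symm
          · have := h1.1 _ h
            have := hlt a (by simp)
            lia
        refine ⟨h1.2, fun x hx => h2 x (List.mem_cons_of_mem _ hx), ?_⟩
        rw [List.sum_cons] at h3
        simp only [List.tail_cons]
        lia⟩, by
      obtain ⟨⟨⟨l, hl⟩, hlt⟩, hm⟩ := l
      match l with
      | [] => simp at hm
      | a :: t =>
        intro x hx
        have h1 := (List.pairwise_cons.1 hl.1).1 x hx
        have := hlt a (by simp)
        lia⟩
  invFun l := ⟨⟨⟨(n + 1) :: l.1.1, by
      obtain ⟨⟨l, hl⟩, hlt⟩ := l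
      refine ⟨List.pairwise_cons.2 ⟨fun x hx => ?_, hl.1⟩, fun x hx => ?_, ?_⟩
      · have := hlt x hx
        lia
      · rcases List.mem_cons.1 hx with rfl | hx
        · lia
        · exact hl.2.1 x hx
      · rw [List.sum_cons, hl.2.2, add_comm]⟩, fun x hx => by
      rcases List.mem_cons.1 hx with rfl | hx
      · lia
      · have := l.2 x hx
        lia⟩, by simp⟩
  left_inv l := by
    obtain ⟨⟨⟨l, hl⟩, hlt⟩, hm⟩ := l
    apply Subtype.ext
    apply Subtype.ext
    apply Subtype.ext
    match l with
    | [] => simp at hm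
    | a :: t =>
      have h1 := (List.pairwise_cons.1 hl.1).1
      rcases List.mem_cons.1 hm with h | h
      · simp [h]
      · have := h1 _ h
        have := hlt a (by simp)
        lia
  right_inv l := rfl

theorem card_diffTwoListLT_not_mem (n N : ℕ) :
    Nat.card {l : DiffTwoListLT (n + 2) N // ¬ n + 1 ∈ l.1.1} =
      Nat.card (DiffTwoListLT (n + 1) N) := by
  refine Nat.card_congr ((Equiv.subtypeSubtypeEquivSubtypeInter _
    (fun l : {l // IsDiffTwoList N l} => ¬ n + 1 ∈ l.1)).trans
    (Equiv.subtypeEquivRight fun l => ⟨fun h x hx => ?_, fun h => ⟨fun x hx => ?_, fun hx => ?_⟩⟩))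
  · have := h.1 x hx
    have : x ≠ n + 1 := fun e => h.2 (e ▸ hx)
    lia
  · have := h x hx
    lia
  · exact lt_irrefl _ (h _ hx)

/-- Split by whether `n + 1` occurs: if so, it comes first and all later entries are below `n`. -/
theorem card_diffTwoListLT_add_two (n N : ℕ) :
    Nat.card (DiffTwoListLT (n + 2) (N + (n + 1))) =
      Nat.card (DiffTwoListLT (n + 1) (N + (n + 1))) + Nat.card (DiffTwoListLT n N) := by
  classical
  rw [← card_diffTwoListLT_not_mem n, ← Nat.card_congr (DiffTwoListLT.tailEquiv n N),
    ← Nat.card_sum]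
  exact Nat.card_congr ((Equiv.sumCompl _).symm.trans (Equiv.sumComm _ _))

/-- The generating function of the lists of `IsDiffTwoList` with all entries smaller than `n`. -/
noncomputable def diffTwoLTSeries (n : ℕ) : ℤ⟦X⟧ :=
  PowerSeries.mk fun N => (Nat.card (DiffTwoListLT n N) : ℤ)

/-- The generating function of the partitions with parts differing by at least two. -/
noncomputable def diffTwoSeries : ℤ⟦X⟧ :=
  PowerSeries.mk fun N => (Nat.card {l // IsDiffTwoList N l} : ℤ)

theorem diffTwoLTSeries_add_two (n : ℕ) :
    diffTwoLTSeries (n + 2) = diffTwoLTSeries (n + 1) + X ^ (n + 1) * diffTwoLTSeries n := by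
  ext N
  rw [map_add, PowerSeries.coeff_X_pow_mul']
  simp only [diffTwoLTSeries, PowerSeries.coeff_mk]
  split_ifs with h
  · obtain ⟨N, rfl⟩ := Nat.exists_eq_add_of_le' h
    rw [card_diffTwoListLT_add_two, Nat.add_sub_cancel, Nat.cast_add]
  · rw [add_zero, ← card_diffTwoListLT_not_mem n, Nat.card_congr (Equiv.subtypeUnivEquiv
      (p := fun l : DiffTwoListLT (n + 2) N => ¬ n + 1 ∈ l.1.1) fun l hm => ?_)]
    have := List.le_sum_of_mem hm
    rw [l.1.2.2.2] at this
    lia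

theorem diffTwoLTSeries_eq_one {n : ℕ} (hn : n ≤ 1) : diffTwoLTSeries n = 1 := by
  have nil_of {N : ℕ} (l : DiffTwoListLT n N) : l.1.1 = [] :=
    List.eq_nil_iff_forall_not_mem.2 fun x hx => by
      have := l.2 x hx
      have := l.1.2.2.1 x hx
      lia
  ext N
  rw [diffTwoLTSeries, PowerSeries.coeff_mk, PowerSeries.coeff_one]
  split_ifs with h
  · subst h
    have : Unique (DiffTwoListLT n 0) :=
      { default := ⟨⟨[], by simp [IsDiffTwoList]⟩, by simp⟩
        uniq := fun l => Subtype.ext (Subtype.ext (nil_of l)) }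
    simp
  · have : IsEmpty (DiffTwoListLT n N) := ⟨fun l => h (by
      rw [← l.1.2.2.2, nil_of l, List.sum_nil])⟩
    simp

theorem diffTwoLTSeries_eq_finsum_schurTerm (n : ℕ) :
    diffTwoLTSeries n = ∑ᶠ j, schurTerm (X : ℤ⟦X⟧) n j := by
  induction n using Nat.twoStepInduction with
  | zero => rw [finsum_schurTerm_zero, diffTwoLTSeries_eq_one (by lia)]
  | one => rw [finsum_schurTerm_one, diffTwoLTSeries_eq_one le_rfl]
  | more n ih1 ih2 => rw [diffTwoLTSeries_add_two, finsum_schurTerm_add_two, ih1, ih2]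

theorem X_pow_dvd_diffTwoSeries_sub (n : ℕ) : X ^ n ∣ diffTwoSeries - diffTwoLTSeries n := by
  rw [PowerSeries.X_pow_dvd_iff]
  intro N hN
  rw [map_sub, diffTwoSeries, diffTwoLTSeries, PowerSeries.coeff_mk, PowerSeries.coeff_mk,
    sub_eq_zero]
  congr 1
  refine (Nat.card_congr (Equiv.subtypeUnivEquiv fun l x hx => ?_)).symm
  have := List.le_sum_of_mem hx
  rw [l.2.2.2] at this
  lia

end DiffTwo

/-! ### The first Rogers–Ramanujan identity -/

section RogersRamanujan

/-- The factors are sorted by their exponents modulo 5. -/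
theorem qFactorial_five_mul {R : Type*} [CommRing R] (q : R) (n : ℕ) :
    qFactorial q (5 * n) = qFactorial (q ^ 5) n *
      (∏ i ∈ Finset.range n, ((1 - q ^ (5 * i + 2)) * (1 - q ^ (5 * i + 3)))) *
      ∏ i ∈ Finset.range n, ((1 - q ^ (5 * i + 1)) * (1 - q ^ (5 * i + 4))) := by
  induction n with
  | zero => simp [qFactorial]
  | succ n ih =>
    rw [Finset.prod_range_succ, Finset.prod_range_succ, qFactorial_succ,
      show 5 * (n + 1) = 5 * n + 1 + 1 + 1 + 1 + 1 by ring]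
    simp only [qFactorial_succ, ih]
    ring

theorem pow_dvd_qFactorial_sub {R : Type*} [CommRing R] (q : R) {K m n : ℕ} (hm : K ≤ m)
    (hmn : m ≤ n) : q ^ K ∣ qFactorial q n - qFactorial q m := by
  obtain ⟨a, rfl⟩ := Nat.exists_eq_add_of_le hmn
  have h := dvd_prod_one_sub_pow_sub_one q (Finset.range a) (fun i => m + i + 1) K
    fun i _ => by lia
  rw [qFactorial, Finset.prod_range_add]
  convert h.mul_left (qFactorial q m) using 1
  rw [qFactorial, mul_sub, mul_one]

/-- The first Rogers–Ramanujan identity. -/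
theorem diffTwoSeries_eq_restrictedSeries :
    diffTwoSeries = restrictedSeries IsOneOrFourModFive := by
  -- With `D`, `R` the two series, `(q)` and `(q⁵)` the `qFactorial`s, and `A`, `B` the products
  -- over residues 1, 4 and 2, 3, modulo `X ^ K`: `(q)₂ₖ D ≡ (q⁵)₂ₖ B ≡ (q⁵)ₖ B ≡ (q⁵)ₖ B A R ≡
  -- (q)₂ₖ R`.
  have key (K : ℕ) : X ^ K ∣ qFactorial X (2 * K) *
      (diffTwoSeries - restrictedSeries IsOneOrFourModFive) := by
    have h1 := (pow_dvd_pow (X : ℤ⟦X⟧) (by lia : K ≤ 2 * K)).trans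
      (X_pow_dvd_diffTwoSeries_sub (2 * K))
    have h2 := pow_dvd_qFactorial_mul_finsum_schurTerm_sub (X : ℤ⟦X⟧) K
    have h3 := (pow_dvd_pow (X : ℤ⟦X⟧) (by lia : K ≤ 5 * K)).trans
      (X_pow_dvd_restrictedSeries_sub_one
        (P := fun x => IsOneOrFourModFive x ∧ 5 * K < x) fun x hx => hx.2)
    have h4 := pow_dvd_qFactorial_sub ((X : ℤ⟦X⟧) ^ 5) le_rfl (by lia : K ≤ 2 * K)
    rw [← pow_mul] at h4
    replace h4 := (pow_dvd_pow (X : ℤ⟦X⟧) (by lia : K ≤ 5 * K)).trans h4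
    have h5 := pow_dvd_qFactorial_sub (X : ℤ⟦X⟧) (by lia : K ≤ 2 * K) (by lia : 2 * K ≤ 5 * K)
    rw [qFactorial_five_mul] at h5
    rw [← restrictedSeries_mul_prod] at h3
    rw [← diffTwoLTSeries_eq_finsum_schurTerm] at h2
    generalize (∏ i ∈ Finset.range K, ((1 - (X : ℤ⟦X⟧) ^ (5 * i + 2)) * (1 - X ^ (5 * i + 3)))) = B
      at *
    generalize (∏ i ∈ Finset.range K, ((1 - (X : ℤ⟦X⟧) ^ (5 * i + 1)) * (1 - X ^ (5 * i + 4)))) = A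
      at *
    convert (((h1.mul_left (qFactorial X (2 * K))).add h2).add (h4.mul_right B)).sub
      ((h3.mul_left (qFactorial (X ^ 5) K * B))) |>.add
        (h5.mul_right (restrictedSeries IsOneOrFourModFive)) using 1
    ring
  ext N
  have hu : IsUnit (qFactorial (X : ℤ⟦X⟧) (2 * (N + 1))) := by
    rw [PowerSeries.isUnit_iff_constantCoeff, qFactorial, map_prod]
    simp
  have h := PowerSeries.X_pow_dvd_iff.1 (hu.dvd_mul_left.1 (key (N + 1))) N (Nat.lt_succ_self N)
  rwa [map_sub, sub_eq_zero] at h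

theorem card_diffTwoList_eq_card_restrictedPartition (N : ℕ) :
    Nat.card {l // IsDiffTwoList N l} = Nat.card (RestrictedPartition IsOneOrFourModFive N) := by
  have h := congrArg (PowerSeries.coeff N) diffTwoSeries_eq_restrictedSeries
  rw [diffTwoSeries, restrictedSeries, PowerSeries.coeff_mk, PowerSeries.coeff_mk] at h
  exact_mod_cast h

end RogersRamanujan

/-! ### Column multiplicities as gaps between parts -/

section Columns

/-- Both sides say that the cell in row `c` and column `j` belongs to the diagram. -/
theorem lt_countP_iff_lt_getD {rows : List ℕ} (h : rows.Pairwise (· ≥ ·)) (j : ℕ) :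
    ∀ c, c < rows.countP (fun r => j < r) ↔ j < rows.getD c 0 := by
  induction rows with
  | nil => simp
  | cons a t ih =>
    obtain ⟨h1, h2⟩ := List.pairwise_cons.1 h
    intro c
    by_cases hj : j < a
    · rw [List.countP_cons_of_pos (by simpa using hj)]
      cases c with
      | zero => simp [hj]
      | succ c => rw [List.getD_cons_succ, ← ih h2]; lia
    · have h0 : t.countP (fun r => j < r) = 0 := by
        rw [List.countP_eq_zero]
        intro x hx
        have := h1 x hx
        simp only [decide_eq_true_eq]
        lia
      rw [List.countP_cons_of_neg (by simpa using hj)]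
      cases c with
      | zero => simp [hj, h0]
      | succ c => rw [List.getD_cons_succ, ← ih h2, h0]; lia

theorem le_foldr_max {l : List ℕ} {x : ℕ} (h : x ∈ l) : x ≤ l.foldr max 0 := by
  induction l with
  | nil => simp at h
  | cons a t ih =>
    rw [List.foldr_cons]
    rcases List.mem_cons.1 h with rfl | h
    · exact le_max_left _ _
    · exact (ih h).trans (le_max_right _ _)

theorem count_columnLengths {rows : List ℕ} (h : rows.Pairwise (· ≥ ·)) (c : ℕ) :
    (columnLengths rows).count (c + 1) = rows.getD c 0 - rows.getD (c + 1) 0 := by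
  have e : (Finset.range (rows.foldr max 0)).filter
      (fun j => c + 1 = rows.countP (fun r => j < r)) =
      Finset.Ico (rows.getD (c + 1) 0) (rows.getD c 0) := by
    ext j
    have h1 := lt_countP_iff_lt_getD h j c
    have h2 := lt_countP_iff_lt_getD h j (c + 1)
    have h3 : j < rows.getD c 0 → j < rows.foldr max 0 := fun hj => by
      rcases lt_or_ge c rows.length with hc | hc
      · rw [List.getD_eq_getElem _ _ hc] at hj
        exact hj.trans_le (le_foldr_max (List.getElem_mem hc))
      · rw [List.getD_eq_default _ _ hc] at hj
        lia
    simp only [Finset.mem_filter, Finset.mem_range, Finset.mem_Ico]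
    lia
  rw [columnLengths, Multiset.count_map, ← Nat.card_Ico, ← e]
  rfl

/-- The list `(l₁ - (2m-1), l₂ - (2m-3), …, l_m - 1)`. -/
def subOdd : List ℕ → List ℕ
  | [] => []
  | a :: t => (a - (2 * t.length + 1)) :: subOdd t

theorem mapIdx_eq_subOdd (l : List ℕ) :
    (l.mapIdx fun i a => a - (2 * (l.length - i) - 1)) = subOdd l := by
  induction l with
  | nil => rfl
  | cons a t ih =>
    rw [List.mapIdx_cons, subOdd, ← ih]
    simp only [List.length_cons, Nat.add_sub_add_right]
    rfl

theorem le_of_mem_subOdd {l : List ℕ} : ∀ {a : ℕ}, (a :: l).IsChain (fun a b => b + 2 ≤ a) →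
    ∀ x ∈ subOdd l, x ≤ a - (2 * l.length + 1) := by
  induction l with
  | nil => simp [subOdd]
  | cons b t ih =>
    intro a h x hx
    rw [List.isChain_cons_cons] at h
    rw [List.length_cons]
    rcases List.mem_cons.1 hx with rfl | hx
    · lia
    · have := ih h.2 x hx
      lia

theorem pairwise_subOdd {l : List ℕ} (h : l.IsChain (fun a b => b + 2 ≤ a)) :
    (subOdd l).Pairwise (· ≥ ·) := by
  induction l with
  | nil => simp [subOdd]
  | cons a t ih => exact List.pairwise_cons.2 ⟨le_of_mem_subOdd h, ih h.tail⟩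

/-- One more than the least value of an entry that may precede the list, except that it is `d` for
the empty list. -/
def leastBefore (d : ℕ) : List ℕ → ℕ
  | [] => d
  | b :: _ => b + 2

/-- The number of columns of length `c + 1`, read off from the list of parts. -/
def columnGap : ℕ → List ℕ → ℕ
  | _, [] => 0
  -- The default is `1` because `1` is subtracted from the last part.
  | 0, a :: t => a - leastBefore 1 t
  | c + 1, _ :: t => columnGap c t

theorem two_mul_length_lt {l : List ℕ} : ∀ {a : ℕ}, (a :: l).IsChain (fun a b => b + 2 ≤ a) →
    (∀ x ∈ a :: l, 0 < x) → 2 * l.length + 1 ≤ a := by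
  induction l with
  | nil => intro a _ h; exact h a (by simp)
  | cons b t ih =>
    intro a h hp
    rw [List.isChain_cons_cons] at h
    have := ih h.2 fun x hx => hp x (List.mem_cons_of_mem _ hx)
    rw [List.length_cons]
    lia

/-- Consecutive subtracted odd numbers differ by two, so a row difference is the excess of a gap
over two. -/
theorem getD_subOdd_sub {l : List ℕ} (h : l.IsChain (fun a b => b + 2 ≤ a))
    (hp : ∀ x ∈ l, 0 < x) (c : ℕ) :
    (subOdd l).getD c 0 - (subOdd l).getD (c + 1) 0 = columnGap c l := by
  induction l generalizing c with
  | nil => simp [subOdd, columnGap]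
  | cons a t ih =>
    have hp' : ∀ x ∈ t, 0 < x := fun x hx => hp x (List.mem_cons_of_mem _ hx)
    cases c with
    | succ c => exact ih h.tail hp' c
    | zero =>
      cases t with
      | nil => simp [subOdd, columnGap, leastBefore]
      | cons b t =>
        have := two_mul_length_lt h.tail hp'
        simp only [subOdd, columnGap, leastBefore, List.getD_cons_zero, List.getD_cons_succ,
          List.length_cons]
        lia

theorem count_col {N : ℕ} (p : Nat.Partition N) (h : IsDiffTwo p) (c : ℕ) :
    (col p).count (c + 1) = columnGap c (partList p) := by
  rw [col, reducedRows, mapIdx_eq_subOdd, count_columnLengths (pairwise_subOdd h),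
    getD_subOdd_sub h]
  intro x hx
  exact p.parts_pos (by rw [← coe_partList]; exact hx)

end Columns

/-! ### Adding and removing a column -/

section ColumnShift

/-- Increase of the first `c` entries by one. -/
def incrFirst : ℕ → List ℕ → List ℕ
  | 0, l => l
  | _ + 1, [] => []
  | c + 1, a :: t => (a + 1) :: incrFirst c t

/-- Decrease of the first `c` entries by one. -/
def decrFirst : ℕ → List ℕ → List ℕ
  | 0, l => l
  | _ + 1, [] => []
  | c + 1, a :: t => (a - 1) :: decrFirst c t

@[simp] theorem length_incrFirst (c : ℕ) (l : List ℕ) : (incrFirst c l).length = l.length := by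
  induction c, l using incrFirst.induct <;> simp_all [incrFirst]

@[simp] theorem length_decrFirst (c : ℕ) (l : List ℕ) : (decrFirst c l).length = l.length := by
  induction c, l using decrFirst.induct <;> simp_all [decrFirst]

theorem sum_incrFirst {c : ℕ} {l : List ℕ} (h : c ≤ l.length) :
    (incrFirst c l).sum = l.sum + c := by
  induction c, l using incrFirst.induct <;> simp_all [incrFirst]; lia

theorem decrFirst_incrFirst (c : ℕ) (l : List ℕ) : decrFirst c (incrFirst c l) = l := by
  induction c, l using incrFirst.induct <;> simp_all [incrFirst, decrFirst]

theorem incrFirst_decrFirst {c : ℕ} {l : List ℕ} (h : ∀ x ∈ l, 0 < x) :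
    incrFirst c (decrFirst c l) = l := by
  induction c, l using decrFirst.induct with
  | case1 l => rfl
  | case2 c => rfl
  | case3 c a t ih =>
    have := h a (by simp)
    rw [decrFirst, incrFirst, ih fun x hx => h x (List.mem_cons_of_mem _ hx),
      Nat.sub_add_cancel this]

theorem pos_of_mem_incrFirst {c : ℕ} {l : List ℕ} (h : ∀ x ∈ l, 0 < x) :
    ∀ x ∈ incrFirst c l, 0 < x := by
  induction c, l using incrFirst.induct <;> simp_all [incrFirst]

theorem isChain_incrFirst {c : ℕ} {l : List ℕ} (h : l.IsChain (fun a b => b + 2 ≤ a)) :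
    (incrFirst c l).IsChain (fun a b => b + 2 ≤ a) := by
  induction c, l using incrFirst.induct with
  | case1 l => exact h
  | case2 c => exact h
  | case3 c a t ih =>
    have ih := ih h.tail
    cases t with
    | nil => cases c <;> simp [incrFirst]
    | cons b t =>
      rw [List.isChain_cons_cons] at h
      cases c with
      | zero =>
        simp only [incrFirst] at ih ⊢
        exact List.isChain_cons_cons.2 ⟨by lia, ih⟩
      | succ c =>
        simp only [incrFirst] at ih ⊢
        exact List.isChain_cons_cons.2 ⟨by lia, ih⟩

theorem columnGap_incrFirst {c : ℕ} {l : List ℕ} (h : l.IsChain (fun a b => b + 2 ≤ a))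
    (hp : ∀ x ∈ l, 0 < x) (hl : c + 1 ≤ l.length) :
    columnGap c (incrFirst (c + 1) l) = columnGap c l + 1 := by
  induction c generalizing l with
  | zero =>
    match l with
    | [a] => have := hp a (by simp); simp only [incrFirst, columnGap, leastBefore]; lia
    | a :: b :: t =>
      rw [List.isChain_cons_cons] at h
      simp only [incrFirst, columnGap, leastBefore]
      lia
  | succ c ih =>
    match l with
    | a :: t =>
      rw [incrFirst, columnGap, columnGap]
      exact ih h.tail (fun x hx => hp x (List.mem_cons_of_mem _ hx)) (by simpa using hl)

/-- Lowering shrinks only the gap after entry `c`, or the last entry if there is none after it; a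
positive `columnGap` is the room needed. -/
theorem isChain_decrFirst {c : ℕ} {l : List ℕ} (h : l.IsChain (fun a b => b + 2 ≤ a))
    (hp : ∀ x ∈ l, 0 < x) (hg : 1 ≤ columnGap c l) :
    (decrFirst (c + 1) l).IsChain (fun a b => b + 2 ≤ a) ∧
      ∀ x ∈ decrFirst (c + 1) l, 0 < x := by
  induction c generalizing l with
  | zero =>
    match l with
    | [] => simp [decrFirst]
    | [a] => simp only [columnGap, leastBefore] at hg; simp [decrFirst]; lia
    | a :: b :: t =>
      rw [List.isChain_cons_cons] at h
      simp only [columnGap, leastBefore] at hg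
      simp only [decrFirst]
      refine ⟨List.isChain_cons_cons.2 ⟨by lia, h.2⟩, fun x hx => ?_⟩
      rcases List.mem_cons.1 hx with rfl | hx
      · lia
      · exact hp x (List.mem_cons_of_mem _ hx)
  | succ c ih =>
    match l with
    | [] => simp [decrFirst]
    | [a] => simp [columnGap] at hg
    | a :: b :: t =>
      have ih := ih h.tail (fun x hx => hp x (List.mem_cons_of_mem _ hx)) hg
      rw [List.isChain_cons_cons] at h
      have := hp b (by simp)
      simp only [decrFirst] at ih ⊢
      refine ⟨List.isChain_cons_cons.2 ⟨by lia, ih.1⟩, fun x hx => ?_⟩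
      rcases List.mem_cons.1 hx with rfl | hx
      · lia
      · exact ih.2 x hx

end ColumnShift

/-! ### Shifting the largest part -/

section HeadShift

/-- Increase of the first entry by `a`, where the empty list is thought of as starting with `0`. -/
def incrHead (a : ℕ) : List ℕ → List ℕ
  | [] => [a]
  | x :: t => (x + a) :: t

/-- Decrease of the first entry by `a`, where an only entry `0` is dropped. -/
def decrHead (a : ℕ) : List ℕ → List ℕ
  | [] => []
  | x :: t => if x = a then [] else (x - a) :: t

/-- How often the first entry can be decreased by `a`. -/
def headQuotient (a : ℕ) : List ℕ → ℕ
  | [] => 0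
  -- The default is `0`, not `1`: a single part may be lowered to nothing, giving the empty
  -- partition. This is why one-part partitions form a separate case of the theorem.
  | x :: t => (x - leastBefore 0 t) / a

/-- The statistic on partitions with parts differing by at least two that corresponds to the
number of parts `M + 1`. -/
def shiftStat (M : ℕ) (l : List ℕ) : ℕ :=
  if l.length ≤ M then headQuotient (M + 1) l else columnGap M l

/-- Raises `shiftStat` by one and the sum by `M + 1`. -/
def shiftUp (M : ℕ) (l : List ℕ) : List ℕ :=
  if l.length ≤ M then incrHead (M + 1) l else incrFirst (M + 1) l

/-- The inverse of `shiftUp`. -/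
def shiftDown (M : ℕ) (l : List ℕ) : List ℕ :=
  if l.length ≤ M then decrHead (M + 1) l else decrFirst (M + 1) l

theorem isDiffTwoList_iff (N : ℕ) (l : List ℕ) : IsDiffTwoList N l ↔
    l.IsChain (fun a b => b + 2 ≤ a) ∧ (∀ x ∈ l, 0 < x) ∧ l.sum = N := by
  rw [IsDiffTwoList, isChain_iff_pairwise_add_two_le]

theorem isDiffTwoList_incrHead {a N : ℕ} (ha : 0 < a) {l : List ℕ} (h : IsDiffTwoList N l) :
    IsDiffTwoList (N + a) (incrHead a l) := by
  rw [isDiffTwoList_iff] at h ⊢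
  obtain ⟨h1, h2, rfl⟩ := h
  match l with
  | [] => simpa [incrHead] using ha
  | [x] => simp [incrHead, ha]
  | x :: y :: t =>
    rw [List.isChain_cons_cons] at h1
    refine ⟨List.isChain_cons_cons.2 ⟨by lia, h1.2⟩, fun z hz => ?_, ?_⟩
    · rcases List.mem_cons.1 hz with rfl | hz
      · lia
      · exact h2 z (List.mem_cons_of_mem _ hz)
    · simp only [incrHead, List.sum_cons]
      lia

theorem isDiffTwoList_decrHead {a N : ℕ} (ha : 0 < a) {l : List ℕ} (h : IsDiffTwoList (N + a) l)
    (hl : 1 ≤ headQuotient a l) :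
    IsDiffTwoList N (decrHead a l) ∧ incrHead a (decrHead a l) = l := by
  rw [isDiffTwoList_iff] at h ⊢
  obtain ⟨h1, h2, h3⟩ := h
  match l with
  | [] => simp [headQuotient] at hl
  | [x] =>
    simp only [headQuotient, leastBefore, Nat.one_le_div_iff ha, List.sum_cons, List.sum_nil] at hl h3
    rw [decrHead]
    split_ifs with hx
    · subst hx
      simp only [incrHead, List.sum_nil]
      simp
      lia
    · simp [incrHead]
      lia
  | x :: y :: t =>
    simp only [headQuotient, leastBefore, Nat.one_le_div_iff ha, List.sum_cons] at hl h3
    rw [List.isChain_cons_cons] at h1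
    rw [decrHead, if_neg (by lia), incrHead, Nat.sub_add_cancel (by lia)]
    refine ⟨⟨List.isChain_cons_cons.2 ⟨by lia, h1.2⟩, fun z hz => ?_, ?_⟩, rfl⟩
    · rcases List.mem_cons.1 hz with rfl | hz
      · lia
      · exact h2 z (List.mem_cons_of_mem _ hz)
    · simp only [List.sum_cons]
      lia

theorem decrHead_incrHead (a : ℕ) {l : List ℕ} (h : ∀ x ∈ l, 0 < x) :
    decrHead a (incrHead a l) = l := by
  match l with
  | [] => simp [incrHead, decrHead]
  | x :: t =>
    have := h x (by simp)
    rw [incrHead, decrHead, if_neg (by lia), Nat.add_sub_cancel]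

theorem headQuotient_incrHead {a : ℕ} (ha : 0 < a) {l : List ℕ}
    (h : l.IsChain (fun a b => b + 2 ≤ a)) :
    headQuotient a (incrHead a l) = headQuotient a l + 1 := by
  match l with
  | [] => simp [incrHead, headQuotient, leastBefore, Nat.div_self ha]
  | [x] => simp [incrHead, headQuotient, leastBefore, Nat.add_div_right _ ha]
  | x :: y :: t =>
    rw [List.isChain_cons_cons] at h
    simp only [incrHead, headQuotient, leastBefore]
    rw [← Nat.add_div_right _ ha]
    congr 1
    lia

/-- The shift must stay within its length class; `1 ≤ M` covers the empty list, which gains an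
entry. -/
theorem length_incrHead_le {a M : ℕ} (hM : 1 ≤ M) {l : List ℕ} (h : l.length ≤ M) :
    (incrHead a l).length ≤ M := by
  cases l <;> simpa [incrHead] using by assumption

theorem length_decrHead_le {a M : ℕ} {l : List ℕ} (h : l.length ≤ M) :
    (decrHead a l).length ≤ M := by
  match l with
  | [] => exact h
  | x :: t =>
    rw [decrHead]
    split_ifs
    · simp
    · exact h

end HeadShift

/-! ### The combined shift and its statistic -/

section ShiftStat

theorem isDiffTwoList_shiftUp {M N : ℕ} {l : List ℕ} (h : IsDiffTwoList N l) :
    IsDiffTwoList (N + (M + 1)) (shiftUp M l) := by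
  rw [shiftUp]
  split_ifs with hl
  · exact isDiffTwoList_incrHead (Nat.succ_pos M) h
  · rw [isDiffTwoList_iff] at h ⊢
    obtain ⟨h1, h2, rfl⟩ := h
    exact ⟨isChain_incrFirst h1, pos_of_mem_incrFirst h2, sum_incrFirst (by lia)⟩

theorem shiftStat_shiftUp {M N : ℕ} (hM : 1 ≤ M) {l : List ℕ} (h : IsDiffTwoList N l) :
    shiftStat M (shiftUp M l) = shiftStat M l + 1 := by
  rw [isDiffTwoList_iff] at h
  unfold shiftStat shiftUp
  by_cases hl : l.length ≤ M
  · rw [if_pos hl, if_pos hl, if_pos (length_incrHead_le hM hl),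
      headQuotient_incrHead (Nat.succ_pos M) h.1]
  · rw [if_neg hl, if_neg hl, if_neg (by rwa [length_incrFirst]),
      columnGap_incrFirst h.1 h.2.1 (by lia)]

theorem shiftDown_shiftUp {M N : ℕ} (hM : 1 ≤ M) {l : List ℕ} (h : IsDiffTwoList N l) :
    shiftDown M (shiftUp M l) = l := by
  unfold shiftDown shiftUp
  by_cases hl : l.length ≤ M
  · rw [if_pos hl, if_pos (length_incrHead_le hM hl), decrHead_incrHead _ h.2.1]
  · rw [if_neg hl, if_neg (by rwa [length_incrFirst]), decrFirst_incrFirst]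

theorem isDiffTwoList_shiftDown {M N : ℕ} {l : List ℕ} (h : IsDiffTwoList (N + (M + 1)) l)
    (hs : 1 ≤ shiftStat M l) :
    IsDiffTwoList N (shiftDown M l) ∧ shiftUp M (shiftDown M l) = l := by
  unfold shiftStat at hs
  unfold shiftDown shiftUp
  by_cases hl : l.length ≤ M
  · rw [if_pos hl] at hs
    rw [if_pos hl, if_pos (length_decrHead_le hl)]
    exact isDiffTwoList_decrHead (Nat.succ_pos M) h hs
  · rw [if_neg hl] at hs
    rw [isDiffTwoList_iff] at h ⊢
    obtain ⟨h1, h2, h3⟩ := h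
    obtain ⟨h4, h5⟩ := isChain_decrFirst h1 h2 hs
    have h6 := incrFirst_decrFirst (c := M + 1) h2
    rw [if_neg hl, if_neg (by rwa [length_decrFirst])]
    refine ⟨⟨h4, h5, ?_⟩, h6⟩
    have h7 := sum_incrFirst (c := M + 1) (l := decrFirst (M + 1) l)
      (by rw [length_decrFirst]; lia)
    rw [h6, h3] at h7
    lia

/-- The lists of `IsDiffTwoList` correspond to those with positive `shiftStat` of a sum larger by
`M + 1`. -/
def shiftEquiv {M : ℕ} (hM : 1 ≤ M) (N : ℕ) : {l // IsDiffTwoList N l} ≃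
    {l : {l // IsDiffTwoList (N + (M + 1)) l} // 1 ≤ shiftStat M l.1} where
  toFun l := ⟨⟨shiftUp M l.1, isDiffTwoList_shiftUp l.2⟩, by
    rw [shiftStat_shiftUp hM l.2]
    lia⟩
  invFun l := ⟨shiftDown M l.1.1, (isDiffTwoList_shiftDown l.1.2 l.2).1⟩
  left_inv l := Subtype.ext (shiftDown_shiftUp hM l.2)
  right_inv l := Subtype.ext (Subtype.ext (isDiffTwoList_shiftDown l.1.2 l.2).2)

theorem shiftStat_eq_zero_of_lt {M N : ℕ} (hN : N < M + 1) {l : List ℕ} (h : IsDiffTwoList N l) :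
    shiftStat M l = 0 := by
  obtain ⟨-, h2, h3⟩ := h
  have hl : l.length ≤ l.sum := List.length_le_sum_of_one_le l h2
  rw [shiftStat, if_pos (by lia)]
  match l with
  | [] => rfl
  | x :: t =>
    rw [List.sum_cons] at h3
    exact Nat.div_eq_of_lt (by lia)

/-- With `2` to `M` parts, the number of columns of length `1` is the numerator in `headQuotient`;
with one part the numerator is `N` itself. The empty partition is excluded by `1 ≤ N`. -/
theorem shiftStat_eq_iff {M N k : ℕ} (hN : 1 ≤ N) (p : Nat.Partition N) (hp : IsDiffTwo p)
    (hM : 1 ≤ M) :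
    ((∃ i ≤ M, N = (M + 1) * k + i ∧ p.parts = {N}) ∨
      ((2 ≤ p.parts.card ∧ p.parts.card ≤ M) ∧
        ((M + 1) * k ≤ (col p).count 1 ∧ (col p).count 1 ≤ (M + 1) * k + M)) ∨
      (M + 1 ≤ p.parts.card ∧ (col p).count (M + 1) = k)) ↔ shiftStat M (partList p) = k := by
  have div_iff (x : ℕ) :
      x / (M + 1) = k ↔ (M + 1) * k ≤ x ∧ x ≤ (M + 1) * k + M := by
    rw [Nat.div_eq_iff (Nat.succ_pos M), mul_comm]
    lia
  have hsum : (partList p).sum = N := by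
    simpa only [← coe_partList, Multiset.sum_coe] using p.parts_sum
  have hcard : p.parts.card = (partList p).length := by rw [← coe_partList, Multiset.coe_card]
  have hparts := coe_partList p
  rw [count_col p hp M, show (col p).count 1 = _ from count_col p hp 0, hcard]
  generalize partList p = l at *
  match l with
  | [] => simp at hsum; lia
  | [x] =>
    have hx : x = N := by simpa using hsum
    subst hx
    rw [shiftStat, if_pos (by simpa using hM), headQuotient, leastBefore, Nat.sub_zero, div_iff,
      ← hparts]
    simp only [List.length_singleton]
    constructor
    · rintro (⟨i, hi, e, -⟩ | h | h) <;> lia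
    · intro h
      exact Or.inl ⟨x - (M + 1) * k, by lia, by lia, rfl⟩
  | x :: y :: t =>
    have hne : p.parts ≠ {N} := fun e => by
      rw [e] at hcard
      simp at hcard
    rw [shiftStat]
    simp only [hne, and_false, exists_false, false_or, List.length_cons, columnGap]
    split_ifs with hl
    · rw [headQuotient, div_iff]
      simp only [leastBefore]
      constructor
      · rintro (h | h) <;> lia
      · intro h
        exact Or.inl ⟨by lia, h⟩
    · constructor
      · rintro (h | h)
        · lia
        · exact h.2
      · intro h
        exact Or.inr ⟨by lia, h⟩

end ShiftStat

theorem mainTheorem6 (M : ℕ) (hM : 2 ≤ M + 1)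
    (hmod : M + 1 ≡ 1 [MOD 5] ∨ M + 1 ≡ 4 [MOD 5])
    (N : ℕ) (hN : 1 ≤ N) (k : ℕ) :
    Nat.card {μ : Nat.Partition N //
        (∀ a ∈ μ.parts, a ≡ 1 [MOD 5] ∨ a ≡ 4 [MOD 5]) ∧ μ.parts.count (M + 1) = k} =
    Nat.card {lam : Nat.Partition N // IsDiffTwo lam ∧
        ((∃ i ≤ M, N = (M + 1) * k + i ∧ lam.parts = {N}) ∨
          ((2 ≤ lam.parts.card ∧ lam.parts.card ≤ M) ∧
            ((M + 1) * k ≤ (col lam).count 1 ∧ (col lam).count 1 ≤ (M + 1) * k + M)) ∨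
          (M + 1 ≤ lam.parts.card ∧ (col lam).count (M + 1) = k))} := by
  have hM1 : 1 ≤ M := by lia
  have h := card_stat_eq_of_card_eq
    (fun N (μ : RestrictedPartition IsOneOrFourModFive N) => μ.1.parts.count (M + 1))
    (fun N (l : {l // IsDiffTwoList N l}) => shiftStat M l.1)
    (RestrictedPartition.insertPart (Nat.succ_pos M) hmod)
    (RestrictedPartition.count_insertPart (Nat.succ_pos M) hmod)
    (fun N hN μ => Nat.Partition.count_eq_zero_of_lt hN μ.1)
    (shiftEquiv hM1) (fun N l => shiftStat_shiftUp hM1 l.2)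
    (fun N hN l => shiftStat_eq_zero_of_lt hN l.2)
    (fun N => (card_diffTwoList_eq_card_restrictedPartition N).symm) k N
  refine Eq.trans ?_ (h.trans ?_)
  · exact Nat.card_congr (Equiv.subtypeSubtypeEquivSubtypeInter _
      (fun μ : Nat.Partition N => μ.parts.count (M + 1) = k)).symm
  · refine Nat.card_congr (((diffTwoEquiv N).subtypeEquiv
      (p := fun p => shiftStat M (partList p.1) = k) fun p => Iff.rfl).symm.trans
      ((Equiv.subtypeSubtypeEquivSubtypeInter _
        (fun p : Nat.Partition N => shiftStat M (partList p) = k)).trans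
      (Equiv.subtypeEquivRight fun p => ?_)))
    exact and_congr_right fun hp => (shiftStat_eq_iff hN p hp hM1).symm
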